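/- **Setting.** Fix an integer $\ell>2$. A partition $\lambda$ is identified with its Young diagram in English notation; $(a,b)$ denotes the position in row $a$ and column $b$ ($a,b\ge 1$; row $1$ is at the top). The *ladder* of $(a,b)$ is the set of all positions $(c,d)$, $c,d\ge 1$, with $c-a=(\ell-1)(b-d)$. The *regularization* $\mathcal R\lambda$ is obtained by moving all boxes of $\lambda$ up to the top of their ladders, i.e. if a ladder contains $m$ boxes of $\lambda$, these come to occupy its $m$ highest positions. The *regularization class* of $\lambda$ is $\mathcal{RC}(\lambda)=\{\mu \text{ a partition}:\mathcal R\mu=\mathcal R\lambda\}$. For partitions $\mu,\nu$ of the same integer, *dominance order* is $\mu\le\nu$ iff $\sum_{j\le i}\mu_j\le\sum_{j\le i}\nu_j$ for all $i$. The *locked* boxes of $\lambda$ are the boxes obtained by repeatedly applying these two rules: (I) a box $x$ of $\lambda$ that lies in the first row or directly below a locked box is locked if every position not in $\lambda$ which lies in the ladder of $x$ below $x$ has directly above it a position that is also not in $\lambda$; (II) every box to the left of a locked box in the same row is locked. All other boxes of $\lambda$ are *unlocked*. Let $\mathcal S\lambda$ be the set of positions obtained from $\lambda$ by leaving all locked boxes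 in place and moving all unlocked boxes down their ladders as far as possible, keeping their order: if a ladder contains $u$ unlocked boxes, they come to occupy the $u$ lowest positions of that ladder that are not occupied by locked boxes. **Theorem.** Let $\ell>2$ and let $\lambda$ be a partition. Then $\mathcal S\lambda$ is (the Young diagram of) a partition, it belongs to $\mathcal{RC}(\lambda)$, and $\mathcal S\lambda\le\mu$ in dominance order for every $\mu\in\mathcal{RC}(\lambda)$; it is the only element of $\mathcal{RC}(\lambda)$ with this property. Moreover, $\mathcal S\lambda$ is the unique partition in $\mathcal{RC}(\lambda)$ all of whose boxes are locked: for $\mu\in\mathcal{RC}(\lambda)$, all boxes of $\mu$ are locked if and only if $\mu=\mathcal S\lambda$. -/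

import Mathlib

/-! Partitions are Young diagrams in English notation: the box `(i, j)` lies in row `i` and column
`j`, both counted from `0`. Positions are arbitrary elements of `ℕ × ℕ`. -/

namespace Ladders

/-- The row in which the ladder through `p` meets the first column: a ladder goes down `ℓ - 1` rows
whenever it goes one column to the left. -/
def ladderIndex (ℓ : ℕ) (p : ℕ × ℕ) : ℕ := p.1 + (ℓ - 1) * p.2

/-- The ladder of the position `p`, as a finite set of positions. -/
def ladder (ℓ : ℕ) (p : ℕ × ℕ) : Finset (ℕ × ℕ) :=
  (Finset.range (ladderIndex ℓ p + 1) ×ˢ Finset.range (ladderIndex ℓ p + 1)).filter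
    fun q => ladderIndex ℓ q = ladderIndex ℓ p

theorem mem_ladder {ℓ : ℕ} (hℓ : 2 < ℓ) {p q : ℕ × ℕ} :
    q ∈ ladder ℓ p ↔ ladderIndex ℓ q = ladderIndex ℓ p := by
  simp only [ladder, Finset.mem_filter, Finset.mem_product, Finset.mem_range,
    and_iff_right_iff_imp]
  intro h
  have h1 : q.2 ≤ (ℓ - 1) * q.2 := Nat.le_mul_of_pos_left _ (by omega)
  simp only [ladderIndex] at *
  constructor <;> omega

/-- The ladder is the line of slope `-(ℓ - 1)`, that is, `(row change) / (column change)`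
equals `-(ℓ - 1)`. -/
theorem mem_ladder_iff_slope {ℓ : ℕ} (hℓ : 2 < ℓ) {a b c d : ℕ} :
    (c, d) ∈ ladder ℓ (a, b) ↔ (c : ℤ) - a = ((ℓ : ℤ) - 1) * ((b : ℤ) - d) := by
  rw [mem_ladder hℓ]
  obtain ⟨k, rfl⟩ : ∃ k, ℓ = k + 1 := ⟨ℓ - 1, by omega⟩
  simp only [ladderIndex, Nat.add_sub_cancel]
  zify
  constructor <;> intro h <;> linarith

/-- The positions occupied after moving all boxes of `lam` up to the top of their ladders:
if a ladder holds `m` boxes of `lam`, they come to occupy its `m` highest positions. -/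
def regularization (ℓ : ℕ) (lam : YoungDiagram) : Set (ℕ × ℕ) :=
  {p | ((ladder ℓ p).filter fun q => q.1 < p.1).card < ((ladder ℓ p).filter (· ∈ lam)).card}

/-- The regularization class of `lam`. -/
def regClass (ℓ : ℕ) (lam : YoungDiagram) : Set YoungDiagram :=
  {mu | regularization ℓ mu = regularization ℓ lam}

/-- Dominance order on the partitions of the same integer: `mu ≤ nu`. -/
def DominanceLE (mu nu : YoungDiagram) : Prop :=
  mu.card = nu.card ∧
    ∀ k : ℕ, ∑ i ∈ Finset.range k, mu.rowLen i ≤ ∑ i ∈ Finset.range k, nu.rowLen i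

/-- The locked boxes of `lam`: the smallest set of boxes that is closed under the two rules. -/
inductive Locked (ℓ : ℕ) (lam : YoungDiagram) : ℕ × ℕ → Prop
  /-- A box of `lam` in the first row or directly below a locked box is locked if every unoccupied
  position below it in its ladder has an unoccupied position directly above it. -/
  | typeI (i j : ℕ) (mem : (i, j) ∈ lam)
      (above : ∀ i', i = i' + 1 → Locked ℓ lam (i', j))
      (below : ∀ c d, (c + 1, d) ∈ ladder ℓ (i, j) → i < c + 1 → (c + 1, d) ∉ lam → (c, d) ∉ lam) :
      Locked ℓ lam (i, j)
  /-- A box to the left of a locked box in the same row is locked. -/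
  | typeII (i j j' : ℕ) (right : Locked ℓ lam (i, j)) (lt : j' < j) : Locked ℓ lam (i, j')

theorem Locked.mem_diagram {ℓ : ℕ} {lam : YoungDiagram} {p : ℕ × ℕ} (h : Locked ℓ lam p) :
    p ∈ lam := by
  induction h with
  | typeI i j mem => exact mem
  | typeII i j j' _ lt ih => exact lam.up_left_mem le_rfl lt.le ih

/-- All boxes of the diagram are locked. -/
def AllLocked (ℓ : ℕ) (lam : YoungDiagram) : Prop := ∀ p ∈ lam, Locked ℓ lam p

open Classical in
/-- The positions occupied after moving all unlocked boxes of `lam` down their ladders while the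
locked boxes stay put: if a ladder holds `u` unlocked boxes, they come to occupy, in the same
order, the `u` lowest positions of the ladder that are not taken by locked boxes. -/
def deregularization (ℓ : ℕ) (lam : YoungDiagram) : Set (ℕ × ℕ) :=
  {p | Locked ℓ lam p ∨
    (¬ Locked ℓ lam p ∧
      ((ladder ℓ p).filter fun q => p.1 < q.1 ∧ ¬ Locked ℓ lam q).card <
        ((ladder ℓ p).filter fun q => q ∈ lam ∧ ¬ Locked ℓ lam q).card)}

end Ladders

namespace Ladders

/-! Put `e = ℓ - 1` and encode a diagram by `m j`, the ladder index of the first empty position of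
column `j`. Ladder `k` contains the box of column `j` iff `k < m j`, so its empty positions
correspond to the `j` with `m j ≤ k`. Hence a regularization class consists of the diagrams whose
sequences have the same multiset of values.

The locked boxes form a diagram, with sequence `A`. Rule (I) stops column `j` at a ladder `m d` with
`d ≤ j`, unless rule (II) forces the column on because of column `j + 1`, that is, unless `m d + e <
A (j + 1)`. So `A` is the greedy sequence of `IsGreedy`. If `p` is the last place of its minimum,
`A` is antitone up to `p` and strictly increasing from `p` on. From `p` on it lies below every
sequence with values among those of `m` (`le_of_values`), so `p` and this tail depend only on the
class (`bottom_unique`).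

Let `s` keep this tail and list the remaining values in decreasing order before `p`. It has the
largest partial sums in the class, hence the largest sums of column lengths; transposing, its
diagram is dominance-minimal. Counting on each ladder shows that it encodes the diagram after moving
the unlocked boxes down (`IsSorted.lt_iff`). A sequence of the class equals its own greedy sequence,
i.e. all boxes are locked, exactly when it is sorted in this sense, and the sorted sequence is
unique. -/

/-- The sequences `j ↦ c j + e * j` with `c` antitone. -/
structure IsEndSeq (e : ℕ) (s : ℕ → ℕ) : Prop where
  le : ∀ j, e * j ≤ s j
  step : ∀ j, s (j + 1) ≤ s j + e

/-- The indices at which a sequence with `j ≤ s j` is at most `k`. -/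
def levelSet (s : ℕ → ℕ) (k : ℕ) : Finset ℕ := (Finset.range (k + 1)).filter fun j => s j ≤ k

/-- Two sequences take every value equally often. -/
def SameLevels (m y : ℕ → ℕ) : Prop := ∀ k, (levelSet m k).card = (levelSet y k).card

theorem IsEndSeq.self_le {e : ℕ} {s : ℕ → ℕ} (he : 0 < e) (h : IsEndSeq e s) (j : ℕ) : j ≤ s j :=
  (Nat.le_mul_of_pos_left _ he).trans (h.le j)

theorem IsEndSeq.mem_levelSet {e : ℕ} {s : ℕ → ℕ} (he : 0 < e) (h : IsEndSeq e s) {j k : ℕ} :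
    j ∈ levelSet s k ↔ s j ≤ k := by
  have := h.self_le he j
  simp only [levelSet, Finset.mem_filter, Finset.mem_range]
  omega

theorem IsEndSeq.le_add {e : ℕ} {s : ℕ → ℕ} (h : IsEndSeq e s) (j : ℕ) : s j ≤ s 0 + e * j := by
  induction j with
  | zero => simp
  | succ j ih => have := h.step j; rw [mul_add]; omega

theorem SameLevels.symm {m y : ℕ → ℕ} (h : SameLevels m y) : SameLevels y m := fun k => (h k).symm

/-- A value of `m` missed by `y` would make the level counts of `m` jump where those of `y` do not.
-/
theorem SameLevels.exists_eq {e : ℕ} {m y : ℕ → ℕ} (he : 0 < e) (hm : IsEndSeq e m)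
    (hy : IsEndSeq e y) (h : SameLevels m y) (j : ℕ) : ∃ d, y d = m j := by
  by_contra! hne
  have key : ∀ k, k ∈ levelSet y (m j) → y k < m j := fun k hk =>
    lt_of_le_of_ne ((hy.mem_levelSet he).1 hk) (hne k)
  have hj : j ∈ levelSet m (m j) := (hm.mem_levelSet he).2 le_rfl
  rcases Nat.eq_zero_or_pos (m j) with h0 | h0
  · have hpos := Finset.card_pos.2 ⟨j, hj⟩
    rw [h (m j)] at hpos
    obtain ⟨k, hk⟩ := Finset.card_pos.1 hpos
    have := key k hk
    omega
  · have h1 : levelSet y (m j) ⊆ levelSet y (m j - 1) := fun k hk => by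
      have := key k hk
      rw [hy.mem_levelSet he]
      omega
    have h2 : levelSet m (m j - 1) ⊂ levelSet m (m j) := by
      refine (Finset.ssubset_iff_of_subset fun k hk => ?_).2 ⟨j, hj, fun hk => ?_⟩
      · rw [hm.mem_levelSet he] at hk ⊢
        omega
      · rw [hm.mem_levelSet he] at hk
        omega
    have h3 := Finset.card_lt_card h2
    have h4 := Finset.card_le_card h1
    rw [h, h] at h3
    omega

/-! ### Greedy sequences and their invariant tail -/

/-- `A j` is the least of the values `m 0, …, m j` that are at least `A (j + 1) - e`. -/
structure IsGreedy (e : ℕ) (m A : ℕ → ℕ) : Prop where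
  pos : 0 < e
  isEndSeq : IsEndSeq e m
  endSeq_min : IsEndSeq e A
  eventually : ∃ N, ∀ j, N ≤ j → m j = e * j
  le : ∀ j, A j ≤ m j
  exists_eq : ∀ j, ∃ d, d ≤ j ∧ A j = m d
  min : ∀ j d, d ≤ j → A (j + 1) ≤ m d + e → A j ≤ m d

/-- `p` is the last index at which `A` takes its least value. -/
def IsBottom (A : ℕ → ℕ) (p : ℕ) : Prop := (∀ j, A p ≤ A j) ∧ ∀ j, p < j → A p < A j

namespace IsGreedy

variable {e : ℕ} {m A : ℕ → ℕ}

theorem exists_isBottom (h : IsGreedy e m A) : ∃ p, IsBottom A p := by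
  obtain ⟨q, hq⟩ : ∃ q, ∀ j, A q ≤ A j := by
    obtain ⟨q, hq⟩ := exists_minimal_of_wellFoundedLT (fun v => v ∈ Set.range A) ⟨A 0, 0, rfl⟩
    obtain ⟨⟨q, rfl⟩, hq⟩ := hq
    exact ⟨q, fun j => by
      by_contra! hlt
      exact absurd (hq ⟨j, rfl⟩ hlt.le) (not_le.2 hlt)⟩
  have hne : (levelSet A (A q)).Nonempty := ⟨q, (h.endSeq_min.mem_levelSet h.pos).2 le_rfl⟩
  have hp := (h.endSeq_min.mem_levelSet h.pos).1 (Finset.max'_mem _ hne)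
  refine ⟨(levelSet A (A q)).max' hne, fun j => hp.trans (hq j), fun j hj => ?_⟩
  by_contra! hle
  exact absurd (Finset.le_max' _ j ((h.endSeq_min.mem_levelSet h.pos).2 (hle.trans hp)))
    (not_le.2 hj)

variable {p : ℕ}

theorem bottom_le (h : IsGreedy e m A) (hp : IsBottom A p) (j : ℕ) : A p ≤ m j :=
  (hp.1 j).trans (h.le j)

/-- If `A (j + 1) ≤ A j`, no `m i` with `i ≤ j` can lie in the window from `A (j + 1) - e` to `A (j
+ 1) - 1`, by minimality. But `m` starts at or below `A p` at some `d ≤ p` and climbs by at most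
`e`, so it stays below the window up to `j`, contradicting `A j ≤ m j`. -/
theorem lt_succ (h : IsGreedy e m A) (hp : IsBottom A p) {j : ℕ} (hj : p ≤ j) :
    A j < A (j + 1) := by
  by_contra! hle
  obtain ⟨d, hdp, hd⟩ := h.exists_eq p
  have hlt := hp.2 (j + 1) (by omega)
  have key : ∀ t, d + t ≤ j → m (d + t) + e < A (j + 1) := by
    intro t
    induction t with
    | zero =>
      intro ht
      by_contra! hc
      have := h.min j d (by omega) hc
      omega
    | succ t ih =>
      intro ht
      have h1 := ih (by omega)
      have h2 := h.isEndSeq.step (d + t)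
      by_contra! hc
      have := h.min j (d + (t + 1)) ht hc
      rw [← add_assoc] at this
      omega
  have h1 := key (j - d) (by omega)
  rw [show d + (j - d) = j by omega] at h1
  have h2 := h.le j
  omega

theorem lt_of_lt (h : IsGreedy e m A) (hp : IsBottom A p) {i j : ℕ} (hi : p ≤ i) (hij : i < j) :
    A i < A j := by
  induction j, hij using Nat.le_induction with
  | base => exact h.lt_succ hp hi
  | succ j hj ih => exact ih.trans (h.lt_succ hp (by omega))

theorem le_of_le (h : IsGreedy e m A) (hp : IsBottom A p) {j : ℕ} (hj : j ≤ p) :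
    ∀ d, d ≤ j → A j ≤ m d := by
  induction hj using Nat.decreasingInduction with
  | self => exact fun d _ => h.bottom_le hp d
  | of_succ j hj ih =>
    exact fun d hd => h.min j d hd ((ih d (by omega)).trans (Nat.le_add_right _ _))

theorem antitone (h : IsGreedy e m A) (hp : IsBottom A p) {i j : ℕ} (hij : i ≤ j) (hj : j ≤ p) :
    A j ≤ A i := by
  obtain ⟨d, hd, hA⟩ := h.exists_eq i
  rw [hA]
  exact h.le_of_le hp hj d (hd.trans hij)

/-- Descending induction from where `m j = e * j`, the least possible value. If `y j = m d` with `d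
≤ j`, minimality of `A j` applies; if `d > j`, then `A j < A d ≤ m d`. -/
theorem le_of_values (h : IsGreedy e m A) (hp : IsBottom A p) {y : ℕ → ℕ} (hy : IsEndSeq e y)
    (hv : ∀ j, ∃ d, m d = y j) {j : ℕ} (hj : p ≤ j) : A j ≤ y j := by
  obtain ⟨N, hN⟩ := h.eventually
  rcases le_total N j with hNj | hjN
  · exact (h.le j).trans ((hN j hNj).trans_le (hy.le j))
  · induction hjN using Nat.decreasingInduction with
    | self => exact (h.le N).trans ((hN N le_rfl).trans_le (hy.le N))
    | of_succ j hjN ih =>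
      have h1 := ih (by omega)
      have h2 := hy.step j
      obtain ⟨d, hd⟩ := hv j
      rw [← hd] at h2 ⊢
      rcases le_or_gt d j with hdj | hjd
      · exact h.min j d hdj (h1.trans h2)
      · exact (h.lt_of_lt hp hj hjd).le.trans (h.le d)

/-- The values of each greedy sequence occur in both `m` and `y`, so `le_of_values` applies in both
directions. -/
theorem bottom_unique (h : IsGreedy e m A) (hp : IsBottom A p) {y B : ℕ → ℕ} {q : ℕ}
    (h' : IsGreedy e y B) (hq : IsBottom B q) (hs : SameLevels m y) :
    p = q ∧ ∀ j, p ≤ j → A j = B j := by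
  have h1 : ∀ j, p ≤ j → A j ≤ B j := fun j hj => h.le_of_values hp h'.endSeq_min (fun j => by
    obtain ⟨d, -, hd⟩ := h'.exists_eq j
    rw [hd]
    exact hs.symm.exists_eq h.pos h'.isEndSeq h.isEndSeq d) hj
  have h2 : ∀ j, q ≤ j → B j ≤ A j := fun j hj => h'.le_of_values hq h.endSeq_min (fun j => by
    obtain ⟨d, -, hd⟩ := h.exists_eq j
    rw [hd]
    exact hs.exists_eq h.pos h.isEndSeq h'.isEndSeq d) hj
  have hb1 : A p ≤ B q := by
    obtain ⟨d, -, hd⟩ := h'.exists_eq q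
    obtain ⟨d', hd'⟩ := hs.symm.exists_eq h.pos h'.isEndSeq h.isEndSeq d
    rw [hd, ← hd']
    exact h.bottom_le hp d'
  have hb2 : B q ≤ A p := by
    obtain ⟨d, -, hd⟩ := h.exists_eq p
    obtain ⟨d', hd'⟩ := hs.exists_eq h.pos h.isEndSeq h'.isEndSeq d
    rw [hd, ← hd']
    exact h'.bottom_le hq d'
  have hpq : p = q := by
    rcases lt_trichotomy p q with hlt | heq | hlt
    · have := hp.2 q hlt
      have := h1 q hlt.le
      have := h2 q le_rfl
      omega
    · exact heq
    · have := hq.2 p hlt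
      have := h1 p le_rfl
      have := h2 p hlt.le
      omega
  exact ⟨hpq, fun j hj => le_antisymm (h1 j hj) (h2 j (hpq ▸ hj))⟩

end IsGreedy

/-! ### Sorted rearrangements: extremality, uniqueness, existence -/

/-- `s` is a rearrangement of `m` that follows `A` from `p` on and is antitone before. -/
structure IsSorted (e : ℕ) (m A : ℕ → ℕ) (p : ℕ) (s : ℕ → ℕ) : Prop where
  isEndSeq : IsEndSeq e s
  sameLevels : SameLevels m s
  eq : ∀ j, p ≤ j → s j = A j
  antitone : ∀ i j, i ≤ j → j ≤ p → s j ≤ s i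

/-- A level set splits into the indices before `p` and those from `p` on. -/
theorem card_levelSet_eq (s : ℕ → ℕ) (k p : ℕ) : (levelSet s k).card =
    ((levelSet s k).filter (· < p)).card + ((levelSet s k).filter (p ≤ ·)).card := by
  rw [← Finset.card_filter_add_card_filter_not (s := levelSet s k) (· < p)]
  simp only [not_lt]

namespace IsSorted

variable {e : ℕ} {m A s : ℕ → ℕ} {p : ℕ}

/-- Suppose `s i ≤ k` for some `i < r`. Then for `j ≥ r`, `y j ≤ k` forces `s j ≤ k`: by minimality
of the tail if `p ≤ j`, and by `s j ≤ s i` otherwise. Since the totals agree, `s` has at most as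
many small values before `r`. -/
theorem card_filter_le (h : IsGreedy e m A) (hp : IsBottom A p) (hs : IsSorted e m A p s)
    {y : ℕ → ℕ} (hy : IsEndSeq e y) (hmy : SameLevels m y) (r k : ℕ) :
    ((levelSet s k).filter (· < r)).card ≤ ((levelSet y k).filter (· < r)).card := by
  rcases ((levelSet s k).filter (· < r)).eq_empty_or_nonempty with h0 | ⟨i, hi⟩
  · simp [h0]
  · rw [Finset.mem_filter, hs.isEndSeq.mem_levelSet h.pos] at hi
    have hsub : (levelSet y k).filter (r ≤ ·) ⊆ (levelSet s k).filter (r ≤ ·) := by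
      intro j hj
      rw [Finset.mem_filter, hy.mem_levelSet h.pos] at hj
      rw [Finset.mem_filter, hs.isEndSeq.mem_levelSet h.pos]
      refine ⟨?_, hj.2⟩
      rcases le_total p j with hpj | hjp
      · rw [hs.eq j hpj]
        exact (h.le_of_values hp hy
          (hmy.symm.exists_eq h.pos hy h.isEndSeq) hpj).trans hj.1
      · exact (hs.antitone i j (by omega) hjp).trans hi.1
    have h1 := Finset.card_le_card hsub
    have h2 := card_levelSet_eq s k r
    have h3 := card_levelSet_eq y k r
    have h4 := hs.sameLevels k
    have h5 := hmy k
    omega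

theorem sum_le (h : IsGreedy e m A) (hp : IsBottom A p) (hs : IsSorted e m A p s)
    {y : ℕ → ℕ} (hy : IsEndSeq e y) (hmy : SameLevels m y) (r : ℕ) :
    ∑ j ∈ Finset.range r, y j ≤ ∑ j ∈ Finset.range r, s j := by
  set K := ∑ j ∈ Finset.range r, (y j + s j) with hK
  have bound : ∀ j ∈ Finset.range r, y j + s j ≤ K := fun j hj =>
    Finset.single_le_sum (f := fun j => y j + s j) (fun _ _ => Nat.zero_le _) hj
  -- Layer-cake formula: `K - f j` counts the levels `k < K` with `f j ≤ k`.
  have key : ∀ f : ℕ → ℕ, IsEndSeq e f → (∀ j ∈ Finset.range r, f j ≤ K) →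
      ∑ j ∈ Finset.range r, f j + ∑ k ∈ Finset.range K, ((levelSet f k).filter (· < r)).card =
        r * K := by
    intro f hf hfK
    have h1 : ∀ k, ((levelSet f k).filter (· < r)).card =
        ∑ j ∈ Finset.range r, if f j ≤ k then 1 else 0 := by
      intro k
      rw [Finset.sum_boole, Nat.cast_id]
      congr 1
      ext j
      simp only [Finset.mem_filter, hf.mem_levelSet h.pos, Finset.mem_range]
      tauto
    simp only [h1]
    rw [Finset.sum_comm, ← Finset.sum_add_distrib,
      Finset.sum_congr rfl (g := fun _ => K), Finset.sum_const, Finset.card_range, smul_eq_mul]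
    intro j hj
    have h2 := hfK j hj
    have h3 : (Finset.range K).filter (f j ≤ ·) = Finset.Ico (f j) K := by
      ext k
      simp only [Finset.mem_filter, Finset.mem_range, Finset.mem_Ico]
      tauto
    rw [Finset.sum_boole, Nat.cast_id, h3, Nat.card_Ico]
    omega
  have h1 := key y hy fun j hj => by have := bound j hj; omega
  have h2 := key s hs.isEndSeq fun j hj => by have := bound j hj; omega
  have h3 : ∑ k ∈ Finset.range K, ((levelSet s k).filter (· < r)).card ≤
      ∑ k ∈ Finset.range K, ((levelSet y k).filter (· < r)).card :=
    Finset.sum_le_sum fun k _ => card_filter_le h hp hs hy hmy r k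
  omega

theorem unique (h : IsGreedy e m A) (hs : IsSorted e m A p s)
    {t : ℕ → ℕ} (ht : IsSorted e m A p t) : s = t := by
  have key : ∀ {s t : ℕ → ℕ}, IsSorted e m A p s → IsSorted e m A p t → ∀ j, s j ≤ t j := by
    intro s t hs ht j
    rcases le_total p j with hpj | hjp
    · rw [hs.eq j hpj, ht.eq j hpj]
    by_contra! hlt
    have h1 : (levelSet s (t j)).filter (p ≤ ·) = (levelSet t (t j)).filter (p ≤ ·) := by
      ext i
      simp only [Finset.mem_filter, hs.isEndSeq.mem_levelSet h.pos,
        ht.isEndSeq.mem_levelSet h.pos]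
      exact and_congr_left fun hi => by rw [hs.eq i hi, ht.eq i hi]
    -- Both sequences are antitone before `p`, so every index there with `s` at most `t j` comes
    -- after `j`, while `j` itself counts only for `t`.
    have h2 : (levelSet s (t j)).filter (· < p) ⊂ (levelSet t (t j)).filter (· < p) := by
      have hj : j < p := by
        refine lt_of_le_of_ne hjp ?_
        rintro rfl
        rw [hs.eq j le_rfl, ht.eq j le_rfl] at hlt
        exact lt_irrefl _ hlt
      refine (Finset.ssubset_iff_of_subset fun i hi => ?_).2 ⟨j, ?_, fun hi => ?_⟩
      · rw [Finset.mem_filter, hs.isEndSeq.mem_levelSet h.pos] at hi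
        rw [Finset.mem_filter, ht.isEndSeq.mem_levelSet h.pos]
        refine ⟨ht.antitone j i ?_ hi.2.le, hi.2⟩
        by_contra! hij
        exact absurd ((hs.antitone i j hij.le hjp).trans hi.1) (not_le.2 hlt)
      · rw [Finset.mem_filter, ht.isEndSeq.mem_levelSet h.pos]
        exact ⟨le_rfl, hj⟩
      · rw [Finset.mem_filter, hs.isEndSeq.mem_levelSet h.pos] at hi
        exact absurd hi.1 (not_le.2 hlt)
    have h3 := Finset.card_lt_card h2
    have h4 := card_levelSet_eq s (t j) p
    have h5 := card_levelSet_eq t (t j) p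
    have h6 := hs.sameLevels (t j)
    have h7 := ht.sameLevels (t j)
    rw [h1] at h4
    omega
  exact funext fun j => le_antisymm (key hs ht j) (key ht hs j)

end IsSorted

namespace IsGreedy

variable {e : ℕ} {m A : ℕ → ℕ} {p : ℕ}

/-- Every value of `A` from `p` on is a value of `m`, and those values are distinct. -/
theorem card_add_card_le (h : IsGreedy e m A) (hp : IsBottom A p) {k k' : ℕ} (hk : k ≤ k') :
    ((levelSet A k').filter (p ≤ ·)).card + (levelSet m k).card ≤
      (levelSet m k').card + ((levelSet A k).filter (p ≤ ·)).card := by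
  choose d _ hd using h.exists_eq
  have hm : levelSet m k ⊆ levelSet m k' := fun j hj => by
    rw [h.isEndSeq.mem_levelSet h.pos] at hj ⊢
    omega
  have hA : (levelSet A k).filter (p ≤ ·) ⊆ (levelSet A k').filter (p ≤ ·) := fun j hj => by
    rw [Finset.mem_filter, h.endSeq_min.mem_levelSet h.pos] at hj ⊢
    omega
  have h1 : ((levelSet A k').filter (p ≤ ·) \ (levelSet A k).filter (p ≤ ·)).card ≤
      (levelSet m k' \ levelSet m k).card := by
    refine Finset.card_le_card_of_injOn d (fun j hj => ?_) fun i hi j hj hij => ?_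
    · simp only [Finset.coe_sdiff, Set.mem_sdiff, Finset.mem_coe, Finset.mem_filter,
        h.endSeq_min.mem_levelSet h.pos, h.isEndSeq.mem_levelSet h.pos] at hj ⊢
      rw [← hd]
      omega
    · simp only [Finset.coe_sdiff, Set.mem_sdiff, Finset.mem_coe, Finset.mem_filter] at hi hj
      have hA : A i = A j := by rw [hd, hd, hij]
      rcases lt_trichotomy i j with hlt | heq | hlt
      · exact absurd hA (h.lt_of_lt hp hi.1.2 hlt).ne
      · exact heq
      · exact absurd hA (h.lt_of_lt hp hj.1.2 hlt).ne'
  rw [Finset.card_sdiff_of_subset hA, Finset.card_sdiff_of_subset hm] at h1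
  have h2 := Finset.card_le_card hm
  have h3 := Finset.card_le_card hA
  omega

theorem levelSet_subset (h : IsGreedy e m A) (k : ℕ) : levelSet m k ⊆ levelSet A k :=
  fun j hj => by
    rw [h.isEndSeq.mem_levelSet h.pos] at hj
    rw [h.endSeq_min.mem_levelSet h.pos]
    exact (h.le j).trans hj

theorem card_levelSet_le (h : IsGreedy e m A) (k : ℕ) :
    (levelSet m k).card ≤ ((levelSet A k).filter (p ≤ ·)).card + p := by
  have h1 := Finset.card_le_card (h.levelSet_subset k)
  have h2 := card_levelSet_eq A k p
  have h3 : ((levelSet A k).filter (· < p)).card ≤ p := by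
    refine (Finset.card_le_card (t := Finset.range p) fun j hj => ?_).trans
      (Finset.card_range p).le
    exact Finset.mem_range.2 (Finset.mem_filter.1 hj).2
  omega

theorem card_filter_le_card_levelSet (h : IsGreedy e m A) (hp : IsBottom A p) (k : ℕ) :
    ((levelSet A k).filter (p ≤ ·)).card ≤ (levelSet m k).card := by
  choose d _ hd using h.exists_eq
  refine Finset.card_le_card_of_injOn d (fun j hj => ?_) fun i hi j hj hij => ?_
  · simp only [Finset.mem_coe, Finset.mem_filter,
      h.endSeq_min.mem_levelSet h.pos, h.isEndSeq.mem_levelSet h.pos] at hj ⊢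
    rw [← hd]
    exact hj.1
  · simp only [Finset.mem_coe, Finset.mem_filter] at hi hj
    have hA : A i = A j := by rw [hd, hd, hij]
    rcases lt_trichotomy i j with hlt | heq | hlt
    · exact absurd hA (h.lt_of_lt hp hi.2 hlt).ne
    · exact heq
    · exact absurd hA (h.lt_of_lt hp hj.2 hlt).ne'

theorem exists_card_levelSet_ge (h : IsGreedy e m A) :
    ∃ k, ((levelSet A k).filter (p ≤ ·)).card + p ≤ (levelSet m k).card := by
  obtain ⟨N, hN⟩ := h.eventually
  -- At level `e * M` all indices up to `M` count for `m`, but only those from `p` to `M` can count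
  -- for the tail of `A`; the summand `p` keeps the subtraction exact.
  set M := m 0 + e * N + N + p
  have he := h.pos
  refine ⟨e * M, ?_⟩
  have h1 : (levelSet A (e * M)).filter (p ≤ ·) ⊆ Finset.Ico p (M + 1) := fun j hj => by
    rw [Finset.mem_filter, h.endSeq_min.mem_levelSet he] at hj
    have := Nat.le_of_mul_le_mul_left ((h.endSeq_min.le j).trans hj.1) he
    rw [Finset.mem_Ico]
    omega
  have h2 : Finset.range (M + 1) ⊆ levelSet m (e * M) := fun j hj => by
    rw [Finset.mem_range] at hj
    rw [h.isEndSeq.mem_levelSet he]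
    rcases le_total N j with hNj | hjN
    · rw [hN j hNj]
      exact Nat.mul_le_mul_left e (by omega)
    · have h3 := h.isEndSeq.le_add j
      have h4 := Nat.mul_le_mul_left e hjN
      have h5 : M ≤ e * M := Nat.le_mul_of_pos_left _ he
      omega
  have h1 := Finset.card_le_card h1
  have h2 := Finset.card_le_card h2
  rw [Nat.card_Ico] at h1
  rw [Finset.card_range] at h2
  omega

/-- Before `p`, `s j` is the `(p - j)`-th smallest value of `m` left over by the tail of `A`. The
second clause says this: `k < s j` iff fewer than `p - j` leftover values are at most `k`. -/
theorem exists_isSorted (h : IsGreedy e m A) (hp : IsBottom A p) :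
    ∃ s, IsSorted e m A p s ∧ ∀ j, j < p → ∀ k, k < s j ↔
      (levelSet m k).card + j < ((levelSet A k).filter (p ≤ ·)).card + p := by
  have hex : ∀ j, ∃ k, ((levelSet A k).filter (p ≤ ·)).card + p ≤ (levelSet m k).card + j :=
    fun j => h.exists_card_levelSet_ge.imp fun k hk => hk.trans (Nat.le_add_right _ _)
  let s : ℕ → ℕ := fun j => if p ≤ j then A j else Nat.find (hex j)
  have hs1 : ∀ j, p ≤ j → s j = A j := fun j hj => if_pos hj
  have hs2 : ∀ j, j < p → ∀ k, k < s j ↔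
      (levelSet m k).card + j < ((levelSet A k).filter (p ≤ ·)).card + p := by
    intro j hj k
    rw [show s j = Nat.find (hex j) from if_neg (not_le.2 hj), Nat.lt_find_iff]
    refine ⟨fun hk => not_le.1 (hk k le_rfl), fun hk k' hk' hle => ?_⟩
    have := h.card_add_card_le hp hk'
    omega
  have hanti' : ∀ i j, i ≤ j → j < p → s j ≤ s i := by
    intro i j hij hj
    by_contra! hlt
    have h1 := (hs2 j hj _).1 hlt
    exact lt_irrefl _ ((hs2 i (by omega) (s i)).2 (by omega))
  have hbot : ∀ j, A p ≤ s j := by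
    intro j
    rcases le_or_gt p j with hj | hj
    · rw [hs1 j hj]
      exact hp.1 j
    · by_contra! hlt
      have h0 : levelSet m (s j) = ∅ := Finset.eq_empty_of_forall_notMem fun i hi => by
        rw [h.isEndSeq.mem_levelSet h.pos] at hi
        exact absurd (h.bottom_le hp i) (by omega)
      refine lt_irrefl _ ((hs2 j hj (s j)).2 ?_)
      rw [h0, Finset.card_empty]
      omega
  have hanti : ∀ i j, i ≤ j → j ≤ p → s j ≤ s i := by
    intro i j hij hj
    rcases hj.lt_or_eq with hj | rfl
    · exact hanti' i j hij hj
    · rw [hs1 j le_rfl]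
      exact hbot i
  have hend : IsEndSeq e s := by
    constructor
    · intro j
      rcases le_or_gt p j with hj | hj
      · rw [hs1 j hj]
        exact h.endSeq_min.le j
      · exact (Nat.mul_le_mul_left e hj.le).trans ((h.endSeq_min.le p).trans (hbot j))
    · intro j
      rcases le_or_gt p j with hj | hj
      · rw [hs1 j hj, hs1 _ (by omega)]
        exact h.endSeq_min.step j
      · exact (hanti j (j + 1) (by omega) hj).trans (Nat.le_add_right _ _)
  refine ⟨s, ⟨hend, fun k => ?_, hs1, hanti⟩, hs2⟩
  have h1 : (levelSet s k).filter (p ≤ ·) = (levelSet A k).filter (p ≤ ·) := by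
    ext i
    simp only [Finset.mem_filter, hend.mem_levelSet h.pos, h.endSeq_min.mem_levelSet h.pos]
    exact and_congr_left fun hi => by rw [hs1 i hi]
  have h2 := h.card_levelSet_le (p := p) k
  have h3 := h.card_filter_le_card_levelSet hp k
  have h4 : (levelSet s k).filter (· < p) = Finset.Ico
      (p + ((levelSet A k).filter (p ≤ ·)).card - (levelSet m k).card) p := by
    ext j
    rw [Finset.mem_filter, hend.mem_levelSet h.pos, Finset.mem_Ico]
    refine and_congr_left fun hj => ?_
    have := hs2 j hj k
    omega
  rw [card_levelSet_eq s k p, h1, h4, Nat.card_Ico]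
  omega

end IsGreedy

/-- A sorted rearrangement is its own greedy sequence. -/
theorem IsSorted.greedy_eq {e : ℕ} {m A s B : ℕ → ℕ} {p : ℕ} (h : IsGreedy e m A)
    (hp : IsBottom A p) (hs : IsSorted e m A p s) (hB : IsGreedy e s B) : B = s := by
  obtain ⟨q, hq⟩ := hB.exists_isBottom
  obtain ⟨rfl, hAB⟩ := h.bottom_unique hp hB hq hs.sameLevels
  funext j
  rcases le_total p j with hj | hj
  · rw [hs.eq j hj, hAB j hj]
  · obtain ⟨d, hd, hBd⟩ := hB.exists_eq j
    exact le_antisymm (hB.le j) (hBd ▸ hs.antitone d j hd hj)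

/-- A rearrangement that is its own greedy sequence is sorted. -/
theorem IsGreedy.isSorted_self {e : ℕ} {m A y : ℕ → ℕ} {p : ℕ} (h : IsGreedy e m A)
    (hp : IsBottom A p) (hy : IsGreedy e y y) (hmy : SameLevels m y) : IsSorted e m A p y := by
  obtain ⟨q, hq⟩ := hy.exists_isBottom
  obtain ⟨rfl, hAy⟩ := h.bottom_unique hp hy hq hmy
  exact ⟨hy.isEndSeq, hmy, fun j hj => (hAy j hj).symm, fun i j hij hj => hy.antitone hq hij hj⟩

/-- Index `k` lies below `s j` iff it lies below `A j` or few enough earlier indices are free. -/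
theorem IsSorted.lt_iff {e : ℕ} {m A s : ℕ → ℕ} {p : ℕ} (h : IsGreedy e m A)
    (hp : IsBottom A p) (hs : IsSorted e m A p s)
    (hlt : ∀ j, j < p → ∀ k, k < s j ↔
      (levelSet m k).card + j < ((levelSet A k).filter (p ≤ ·)).card + p) (j k : ℕ) :
    k < s j ↔ k < A j ∨ (A j ≤ k ∧
      ((levelSet A k).filter (· < j)).card < (levelSet A k \ levelSet m k).card) := by
  have h1 := Finset.card_le_card (h.levelSet_subset k)
  rw [Finset.card_sdiff_of_subset (h.levelSet_subset k)]
  have h2 := card_levelSet_eq A k j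
  have h3 := card_levelSet_eq A k p
  have h4 := h.card_filter_le_card_levelSet hp k
  rcases le_or_gt p j with hj | hj
  · have h5 : (levelSet A k).filter (j ≤ ·) ⊆ (levelSet A k).filter (p ≤ ·) := fun i hi => by
      rw [Finset.mem_filter] at hi ⊢
      exact ⟨hi.1, hj.trans hi.2⟩
    have h5 := Finset.card_le_card h5
    rw [hs.eq j hj]
    omega
  · rw [hlt j hj]
    have h5 : ∀ i, i ≤ p → ((levelSet A k).filter (i ≤ ·)).card =
        ((levelSet A k).filter fun t => i ≤ t ∧ t < p).card +
          ((levelSet A k).filter (p ≤ ·)).card := by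
      intro i hi
      rw [← Finset.card_filter_add_card_filter_not (s := (levelSet A k).filter (i ≤ ·)) (· < p),
        Finset.filter_filter, Finset.filter_filter]
      congr 2
      ext t
      simp only [Finset.mem_filter, not_lt]
      exact and_congr_right fun _ => ⟨fun h => h.2, fun h => ⟨hi.trans h, h⟩⟩
    rcases le_or_gt (A j) k with hk | hk
    · have h6 : ((levelSet A k).filter fun t => j ≤ t ∧ t < p) = Finset.Ico j p := by
        ext t
        rw [Finset.mem_filter, h.endSeq_min.mem_levelSet h.pos, Finset.mem_Ico]
        exact and_iff_right_of_imp fun ht => (h.antitone hp ht.1 ht.2.le).trans hk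
      have h7 := h5 j hj.le
      rw [h6, Nat.card_Ico] at h7
      omega
    · have h6 : ((levelSet A k).filter (· < p)).card ≤ p - (j + 1) := by
        rw [← Nat.card_Ico]
        refine Finset.card_le_card fun t ht => ?_
        rw [Finset.mem_filter, h.endSeq_min.mem_levelSet h.pos] at ht
        rw [Finset.mem_Ico]
        refine ⟨?_, ht.2⟩
        by_contra! htj
        exact absurd ((h.antitone hp (Nat.le_of_lt_succ htj) hj.le).trans ht.1) (not_le.2 hk)
      simp only [hk, true_or, iff_true]
      omega


/-! ### Encoding diagrams and counting on ladders -/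

/-- The index of the ladder just after the last box of column `j`. -/
def ladderEnd (ℓ : ℕ) (mu : YoungDiagram) (j : ℕ) : ℕ := mu.colLen j + (ℓ - 1) * j

theorem mem_iff_lt_ladderEnd (ℓ : ℕ) (mu : YoungDiagram) (p : ℕ × ℕ) :
    p ∈ mu ↔ ladderIndex ℓ p < ladderEnd ℓ mu p.2 := by
  rw [← Prod.mk.eta (p := p), YoungDiagram.mem_iff_lt_colLen]
  simp [ladderIndex, ladderEnd]

theorem isEndSeq_ladderEnd (ℓ : ℕ) (mu : YoungDiagram) : IsEndSeq (ℓ - 1) (ladderEnd ℓ mu) where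
  le j := Nat.le_add_left _ _
  step j := by
    have := mu.colLen_anti j (j + 1) j.le_succ
    simp only [ladderEnd, mul_add, mul_one]
    omega

theorem ladderEnd_injective (ℓ : ℕ) : Function.Injective (ladderEnd ℓ) := by
  intro mu nu h
  ext p
  rw [YoungDiagram.mem_cells, YoungDiagram.mem_cells, mem_iff_lt_ladderEnd ℓ,
    mem_iff_lt_ladderEnd ℓ, h]

theorem ladderEnd_eventually (ℓ : ℕ) (mu : YoungDiagram) :
    ∃ N, ∀ j, N ≤ j → ladderEnd ℓ mu j = (ℓ - 1) * j := by
  refine ⟨mu.rowLen 0, fun j hj => ?_⟩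
  have h : (0, j) ∉ mu := by
    rw [YoungDiagram.mem_iff_lt_rowLen]
    omega
  rw [YoungDiagram.mem_iff_lt_colLen] at h
  simp only [ladderEnd]
  omega

theorem exists_ladderEnd_eq {ℓ : ℕ} {s : ℕ → ℕ} (hs : IsEndSeq (ℓ - 1) s)
    (hN : ∃ N, ∀ j, N ≤ j → s j = (ℓ - 1) * j) : ∃ S : YoungDiagram, ladderEnd ℓ S = s := by
  obtain ⟨N, hN⟩ := hN
  let S : YoungDiagram :=
    { cells := (Finset.range (s 0) ×ˢ Finset.range N).filter
        fun p => p.1 + (ℓ - 1) * p.2 < s p.2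
      isLowerSet := by
        have hanti : ∀ j t, s (j + t) ≤ s j + (ℓ - 1) * t := by
          intro j t
          induction t with
          | zero => simp
          | succ t ih =>
            have := hs.step (j + t)
            rw [← add_assoc, mul_add]
            omega
        rintro ⟨a, b⟩ ⟨c, d⟩ ⟨h1, h2⟩ hab
        simp only [Finset.coe_filter, Finset.mem_product, Finset.mem_range,
          Set.mem_ofPred_eq] at hab h1 h2 ⊢
        obtain ⟨t, rfl⟩ := Nat.exists_eq_add_of_le h2
        have := hanti d t
        have h3 := hab.2
        rw [mul_add] at h3
        omega }
  have hS : ∀ i j, (i, j) ∈ S ↔ i + (ℓ - 1) * j < s j := by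
    intro i j
    rw [← YoungDiagram.mem_cells]
    simp only [S, Finset.mem_filter, Finset.mem_product, Finset.mem_range]
    refine and_iff_right_of_imp fun h => ⟨?_, ?_⟩
    · have := hs.le_add j
      omega
    · by_contra! hj
      rw [hN j hj] at h
      omega
  refine ⟨S, funext fun j => ?_⟩
  have h1 : ∀ i, i < S.colLen j ↔ i + (ℓ - 1) * j < s j := fun i => by
    rw [← YoungDiagram.mem_iff_lt_colLen, hS]
  have h2 := h1 (S.colLen j)
  have h3 := h1 (s j - (ℓ - 1) * j)
  have h4 := hs.le j
  simp only [ladderEnd]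
  omega

theorem card_ladder_filter {ℓ : ℕ} (hℓ : 2 < ℓ) (p : ℕ × ℕ) (P : ℕ × ℕ → Prop)
    [DecidablePred P] : ((ladder ℓ p).filter P).card =
      ((Finset.range (ladderIndex ℓ p + 1)).filter fun j =>
        (ℓ - 1) * j ≤ ladderIndex ℓ p ∧ P (ladderIndex ℓ p - (ℓ - 1) * j, j)).card := by
  refine Finset.card_bij' (fun q _ => q.2)
    (fun j _ => (ladderIndex ℓ p - (ℓ - 1) * j, j)) ?_ ?_ ?_ ?_
  · rintro ⟨a, b⟩ hq
    rw [Finset.mem_filter, mem_ladder hℓ] at hq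
    obtain ⟨h1, h2⟩ := hq
    have h3 : b ≤ (ℓ - 1) * b := Nat.le_mul_of_pos_left _ (by omega)
    rw [Finset.mem_filter, Finset.mem_range, ← h1]
    simp only [ladderIndex, Nat.add_sub_cancel]
    exact ⟨by omega, by omega, h2⟩
  · intro j hj
    rw [Finset.mem_filter] at hj ⊢
    refine ⟨(mem_ladder hℓ).2 ?_, hj.2.2⟩
    rw [ladderIndex]
    exact Nat.sub_add_cancel hj.2.1
  · rintro ⟨a, b⟩ hq
    rw [Finset.mem_filter, mem_ladder hℓ] at hq
    rw [← hq.1]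
    simp [ladderIndex]
  · intro j _
    rfl

theorem ladderIndex_sub {ℓ k j : ℕ} (h : (ℓ - 1) * j ≤ k) :
    ladderIndex ℓ (k - (ℓ - 1) * j, j) = k := Nat.sub_add_cancel h

theorem card_ladder_add_card_levelSet {ℓ : ℕ} (hℓ : 2 < ℓ) (mu : YoungDiagram) (p : ℕ × ℕ) :
    ((ladder ℓ p).filter (· ∈ mu)).card + (levelSet (ladderEnd ℓ mu) (ladderIndex ℓ p)).card =
      (ladder ℓ p).card := by
  have hend := isEndSeq_ladderEnd ℓ mu
  rw [← Finset.card_filter_add_card_filter_not (s := ladder ℓ p) (· ∈ mu), add_right_inj,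
    card_ladder_filter hℓ, levelSet]
  congr 1
  refine Finset.filter_congr fun j _ => ?_
  rw [mem_iff_lt_ladderEnd ℓ]
  constructor
  · intro h
    have h1 := (hend.le j).trans h
    rw [ladderIndex_sub h1]
    exact ⟨h1, not_lt.2 h⟩
  · rintro ⟨h1, h2⟩
    rw [ladderIndex_sub h1] at h2
    exact not_lt.1 h2

theorem card_ladder_above {ℓ : ℕ} (hℓ : 2 < ℓ) (p : ℕ × ℕ) :
    ((ladder ℓ p).filter fun q => q.1 < p.1).card = ladderIndex ℓ p / (ℓ - 1) - p.2 := by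
  rw [card_ladder_filter hℓ, ← Nat.card_Ioc p.2 (ladderIndex ℓ p / (ℓ - 1))]
  congr 1
  ext j
  have h3 : j ≤ (ℓ - 1) * j := Nat.le_mul_of_pos_left _ (by omega)
  have h4 : p.2 < j ↔ (ℓ - 1) * p.2 < (ℓ - 1) * j :=
    (Nat.mul_lt_mul_left (by omega)).symm
  rw [Finset.mem_filter, Finset.mem_range, Finset.mem_Ioc, Nat.le_div_iff_mul_le (by omega),
    mul_comm j, h4]
  simp only [ladderIndex]
  omega

theorem card_ladder {ℓ : ℕ} (hℓ : 2 < ℓ) (p : ℕ × ℕ) :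
    (ladder ℓ p).card = ladderIndex ℓ p / (ℓ - 1) + 1 := by
  have h := card_ladder_filter hℓ p fun _ => True
  rw [Finset.filter_true_of_mem fun _ _ => trivial] at h
  rw [h, ← Finset.card_range (ladderIndex ℓ p / (ℓ - 1) + 1)]
  congr 1
  ext j
  have h3 : j ≤ (ℓ - 1) * j := Nat.le_mul_of_pos_left _ (by omega)
  rw [Finset.mem_filter, Finset.mem_range, Finset.mem_range,
    Nat.lt_succ_iff (n := ladderIndex ℓ p / (ℓ - 1)),
    Nat.le_div_iff_mul_le (by omega), mul_comm j, and_true]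
  omega

theorem ladder_congr {ℓ : ℕ} (hℓ : 2 < ℓ) {p q : ℕ × ℕ} (h : ladderIndex ℓ p = ladderIndex ℓ q) :
    ladder ℓ p = ladder ℓ q := by
  ext r
  rw [mem_ladder hℓ, mem_ladder hℓ, h]

/-- Otherwise the position with exactly `n` others above it in the ladder lies in the regularization
of `nu` but not in that of `mu`. -/
theorem card_ladder_filter_le_of_regularization_eq {ℓ : ℕ} (hℓ : 2 < ℓ) {mu nu : YoungDiagram}
    (h : regularization ℓ mu = regularization ℓ nu) (p : ℕ × ℕ) :
    ((ladder ℓ p).filter (· ∈ nu)).card ≤ ((ladder ℓ p).filter (· ∈ mu)).card := by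
  by_contra! hlt
  set n := ((ladder ℓ p).filter (· ∈ mu)).card with hn
  have h1 : n < ladderIndex ℓ p / (ℓ - 1) + 1 := by
    rw [← card_ladder hℓ]
    exact hlt.trans_le (Finset.card_filter_le _ _)
  set j := ladderIndex ℓ p / (ℓ - 1) - n with hj
  have h2 : (ℓ - 1) * j ≤ ladderIndex ℓ p :=
    (Nat.mul_le_mul_left _ (Nat.sub_le _ _)).trans (Nat.mul_div_le _ _)
  have h3 := ladderIndex_sub h2
  have h4 := ladder_congr hℓ h3
  have h5 : (ladderIndex ℓ p - (ℓ - 1) * j, j) ∈ regularization ℓ nu := by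
    simp only [regularization, Set.mem_ofPred_eq, card_ladder_above hℓ]
    rw [h4, h3]
    omega
  rw [← h] at h5
  simp only [regularization, Set.mem_ofPred_eq, card_ladder_above hℓ] at h5
  rw [h4, h3] at h5
  omega

theorem mem_regClass_iff {ℓ : ℕ} (hℓ : 2 < ℓ) {lam mu : YoungDiagram} :
    mu ∈ regClass ℓ lam ↔ SameLevels (ladderEnd ℓ lam) (ladderEnd ℓ mu) := by
  constructor
  · intro h k
    have h1 := card_ladder_filter_le_of_regularization_eq hℓ h (k, 0)
    have h2 := card_ladder_filter_le_of_regularization_eq hℓ h.symm (k, 0)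
    have h3 := card_ladder_add_card_levelSet hℓ lam (k, 0)
    have h4 := card_ladder_add_card_levelSet hℓ mu (k, 0)
    rw [show ladderIndex ℓ (k, 0) = k by simp [ladderIndex]] at h3 h4
    omega
  · intro h
    have h1 : ∀ p, ((ladder ℓ p).filter (· ∈ mu)).card = ((ladder ℓ p).filter (· ∈ lam)).card := by
      intro p
      have h3 := card_ladder_add_card_levelSet hℓ lam p
      have h4 := card_ladder_add_card_levelSet hℓ mu p
      have := h (ladderIndex ℓ p)
      omega
    simp only [regClass, Set.mem_ofPred_eq, regularization, h1]

theorem card_eq_of_mem_regClass {ℓ : ℕ} (hℓ : 2 < ℓ) {lam mu : YoungDiagram}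
    (h : mu ∈ regClass ℓ lam) : mu.card = lam.card := by
  have key : ∀ nu : YoungDiagram, ∀ K : ℕ, nu.cells.sup (ladderIndex ℓ) < K →
      nu.card = ∑ k ∈ Finset.range K, ((ladder ℓ (k, 0)).filter (· ∈ nu)).card := by
    intro nu K hK
    rw [YoungDiagram.card, Finset.card_eq_sum_card_fiberwise (f := ladderIndex ℓ)
      (t := Finset.range K) fun q hq => Finset.mem_coe.2 (Finset.mem_range.2
        ((Finset.le_sup (f := ladderIndex ℓ) hq).trans_lt hK))]
    refine Finset.sum_congr rfl fun k _ => congrArg _ ?_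
    ext q
    rw [Finset.mem_filter, Finset.mem_filter, mem_ladder hℓ, YoungDiagram.mem_cells]
    simp only [ladderIndex, mul_zero, add_zero]
    exact and_comm
  rw [key mu (mu.cells.sup (ladderIndex ℓ) + lam.cells.sup (ladderIndex ℓ) + 1) (by omega),
    key lam (mu.cells.sup (ladderIndex ℓ) + lam.cells.sup (ladderIndex ℓ) + 1) (by omega)]
  refine Finset.sum_congr rfl fun k _ => le_antisymm ?_ ?_
  · exact card_ladder_filter_le_of_regularization_eq hℓ h.symm _
  · exact card_ladder_filter_le_of_regularization_eq hℓ h _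

/-! ### Locked boxes as a greedy sequence -/

theorem Locked.above {ℓ : ℕ} {lam : YoungDiagram} {p : ℕ × ℕ} (h : Locked ℓ lam p) :
    ∀ i, p.1 = i + 1 → Locked ℓ lam (i, p.2) := by
  induction h with
  | typeI i j mem above below => exact above
  | typeII i j j' right lt ih => exact fun i' hi' => .typeII i' j j' (ih i' hi') lt

theorem Locked.of_le {ℓ : ℕ} {lam : YoungDiagram} {i j i' j' : ℕ} (h : Locked ℓ lam (i, j))
    (hi : i' ≤ i) (hj : j' ≤ j) : Locked ℓ lam (i', j') := by
  have h1 : Locked ℓ lam (i', j) := by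
    induction hi using Nat.decreasingInduction with
    | self => exact h
    | of_succ t ht ih => exact ih.above t rfl
  rcases hj.lt_or_eq with hj | rfl
  · exact .typeII i' j j' h1 hj
  · exact h1

open Classical in
/-- The locked boxes form a Young diagram. -/
noncomputable def lockedDiagram (ℓ : ℕ) (lam : YoungDiagram) : YoungDiagram where
  cells := lam.cells.filter (Locked ℓ lam)
  isLowerSet := by
    rintro ⟨a, b⟩ ⟨c, d⟩ ⟨h1, h2⟩ hab
    rw [Finset.mem_coe, Finset.mem_filter] at hab ⊢
    have := hab.2.of_le h1 h2
    exact ⟨this.mem_diagram, this⟩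

theorem mem_lockedDiagram {ℓ : ℕ} {lam : YoungDiagram} {p : ℕ × ℕ} :
    p ∈ lockedDiagram ℓ lam ↔ Locked ℓ lam p := by
  classical
  rw [← YoungDiagram.mem_cells, lockedDiagram, Finset.mem_filter]
  exact and_iff_right_of_imp Locked.mem_diagram

theorem allLocked_iff {ℓ : ℕ} {lam : YoungDiagram} :
    AllLocked ℓ lam ↔ lockedDiagram ℓ lam = lam := by
  constructor
  · intro h
    ext p
    rw [YoungDiagram.mem_cells, YoungDiagram.mem_cells, mem_lockedDiagram]
    exact ⟨Locked.mem_diagram, h p⟩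
  · intro h p hp
    rw [← mem_lockedDiagram, h]
    exact hp

theorem not_mem_and_above_mem_iff (ℓ : ℕ) {lam : YoungDiagram} {c d : ℕ} :
    ((c + 1, d) ∉ lam ∧ (c, d) ∈ lam) ↔ ladderEnd ℓ lam d = ladderIndex ℓ (c + 1, d) := by
  rw [mem_iff_lt_ladderEnd ℓ, mem_iff_lt_ladderEnd ℓ]
  simp only [ladderIndex]
  omega

theorem isGreedy_lockedDiagram {ℓ : ℕ} (hℓ : 2 < ℓ) (lam : YoungDiagram) :
    IsGreedy (ℓ - 1) (ladderEnd ℓ lam) (ladderEnd ℓ (lockedDiagram ℓ lam)) where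
  pos := by omega
  isEndSeq := isEndSeq_ladderEnd ℓ lam
  endSeq_min := isEndSeq_ladderEnd ℓ _
  eventually := ladderEnd_eventually ℓ lam
  le j := by
    by_contra! hlt
    have h1 : (lam.colLen j, j) ∈ lockedDiagram ℓ lam := by
      rw [mem_iff_lt_ladderEnd ℓ]
      exact hlt
    have h2 := YoungDiagram.mem_iff_lt_colLen.1 (mem_lockedDiagram.1 h1).mem_diagram
    exact lt_irrefl _ h2
  exists_eq j := by
    set a := (lockedDiagram ℓ lam).colLen j with ha
    have hnot : ¬ Locked ℓ lam (a, j) := by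
      rw [← mem_lockedDiagram, YoungDiagram.mem_iff_lt_colLen]
      exact lt_irrefl _
    have habove : ∀ i, a = i + 1 → Locked ℓ lam (i, j) := by
      intro i hi
      rw [← mem_lockedDiagram, YoungDiagram.mem_iff_lt_colLen]
      omega
    by_cases hmem : (a, j) ∈ lam
    -- Rule (I) fails at the first unlocked position of column `j`, so the first empty position of
    -- some column `d` lies lower in the same ladder.
    · have hbelow : ¬ ∀ c d, (c + 1, d) ∈ ladder ℓ (a, j) → a < c + 1 → (c + 1, d) ∉ lam →
          (c, d) ∉ lam := fun hb => hnot (.typeI a j hmem habove hb)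
      push Not at hbelow
      obtain ⟨c, d, h1, h2, h3, h4⟩ := hbelow
      have h5 := (not_mem_and_above_mem_iff ℓ).1 ⟨h3, h4⟩
      rw [mem_ladder hℓ] at h1
      refine ⟨d, ?_, by rw [h5, h1]; rfl⟩
      by_contra! hlt
      have := Nat.mul_le_mul_left (ℓ - 1) hlt.le
      simp only [ladderIndex] at h1
      omega
    · refine ⟨j, le_rfl, ?_⟩
      rw [YoungDiagram.mem_iff_lt_colLen, not_lt] at hmem
      have : a ≤ lam.colLen j := by
        by_contra! hlt
        have h1 : (lam.colLen j, j) ∈ lockedDiagram ℓ lam := by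
          rw [YoungDiagram.mem_iff_lt_colLen]
          exact hlt
        have h2 := YoungDiagram.mem_iff_lt_colLen.1 (mem_lockedDiagram.1 h1).mem_diagram
        exact lt_irrefl _ h2
      simp only [ladderEnd]
      omega
  min j d hd hle := by
    by_contra! hlt
    have h0 : (ℓ - 1) * j ≤ ladderEnd ℓ lam d := by
      have := (isEndSeq_ladderEnd ℓ (lockedDiagram ℓ lam)).le (j + 1)
      rw [mul_add] at this
      omega
    set i := ladderEnd ℓ lam d - (ℓ - 1) * j with hi
    have h1 : Locked ℓ lam (i, j) := by
      rw [← mem_lockedDiagram, mem_iff_lt_ladderEnd ℓ, ladderIndex_sub h0]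
      exact hlt
    cases h1 with
    | typeI _ _ mem above below =>
      rcases hd.lt_or_eq with hd | rfl
      · have h2 := Nat.mul_le_mul_left (ℓ - 1) (Nat.succ_le_of_lt hd)
        rw [Nat.succ_eq_add_one, mul_add] at h2
        -- Since `d < j` and `(ℓ - 1) * j ≤ ladderEnd ℓ lam d`, column `d` is nonempty, so its first
        -- empty position has a box above it and violates rule (I).
        obtain ⟨c, hc⟩ : ∃ c, c + 1 + (ℓ - 1) * d = ladderEnd ℓ lam d :=
          ⟨ladderEnd ℓ lam d - (ℓ - 1) * d - 1, by omega⟩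
        obtain ⟨h3, h4⟩ := (not_mem_and_above_mem_iff ℓ).2 hc.symm
        refine below c d ?_ (by omega) h3 h4
        rw [mem_ladder hℓ, ladderIndex_sub h0]
        exact hc
      · rw [mem_iff_lt_ladderEnd ℓ, ladderIndex_sub h0] at mem
        exact lt_irrefl _ mem
    | typeII _ j' _ right lt =>
      have h2 := right.of_le le_rfl (Nat.succ_le_of_lt lt)
      rw [← mem_lockedDiagram, mem_iff_lt_ladderEnd ℓ] at h2
      simp only [ladderIndex, Nat.succ_eq_add_one, mul_add] at h2
      omega

/-- Lower in a ladder means further left, so free places below `p` become columns `j < p.2` at level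
`ladderIndex ℓ p`. -/
theorem mem_deregularization_iff {ℓ : ℕ} (hℓ : 2 < ℓ) (lam : YoungDiagram) (p : ℕ × ℕ) :
    p ∈ deregularization ℓ lam ↔
      ladderIndex ℓ p < ladderEnd ℓ (lockedDiagram ℓ lam) p.2 ∨
        (ladderEnd ℓ (lockedDiagram ℓ lam) p.2 ≤ ladderIndex ℓ p ∧
          ((levelSet (ladderEnd ℓ (lockedDiagram ℓ lam)) (ladderIndex ℓ p)).filter
            (· < p.2)).card <
          (levelSet (ladderEnd ℓ (lockedDiagram ℓ lam)) (ladderIndex ℓ p) \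
            levelSet (ladderEnd ℓ lam) (ladderIndex ℓ p)).card) := by
  classical
  have hg := isGreedy_lockedDiagram hℓ lam
  simp only [deregularization, Set.mem_ofPred_eq, ← mem_lockedDiagram]
  rw [card_ladder_filter hℓ, card_ladder_filter hℓ]
  have h1 : ∀ j, j < p.2 ↔ (ℓ - 1) * j < (ℓ - 1) * p.2 := fun j =>
    (Nat.mul_lt_mul_left (by omega)).symm
  refine or_congr (mem_iff_lt_ladderEnd ℓ _ p) (and_congr ?_ ?_)
  · rw [mem_iff_lt_ladderEnd ℓ, not_lt]
  · refine iff_of_eq (congrArg₂ (fun s t : Finset ℕ => s.card < t.card) ?_ ?_)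
    · ext j
      have h2 := hg.endSeq_min.le j
      have h3 := hg.endSeq_min.self_le hg.pos j
      rw [Finset.mem_filter, Finset.mem_filter, hg.endSeq_min.mem_levelSet hg.pos,
        Finset.mem_range, h1]
      by_cases h4 : (ℓ - 1) * j ≤ ladderIndex ℓ p
      · rw [mem_iff_lt_ladderEnd ℓ, ladderIndex_sub h4]
        simp only [ladderIndex] at h4 ⊢
        omega
      · omega
    · ext j
      have h2 := hg.endSeq_min.le j
      have h3 := hg.endSeq_min.self_le hg.pos j
      rw [Finset.mem_filter, Finset.mem_sdiff, hg.endSeq_min.mem_levelSet hg.pos,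
        hg.isEndSeq.mem_levelSet hg.pos, Finset.mem_range]
      by_cases h4 : (ℓ - 1) * j ≤ ladderIndex ℓ p
      · rw [mem_iff_lt_ladderEnd ℓ, mem_iff_lt_ladderEnd ℓ, ladderIndex_sub h4]
        dsimp only
        omega
      · omega

/-! ### Dominance order and conclusion -/

/-- Dominance order is reversed by transposition. -/
theorem dominanceLE_of_colLen {mu nu : YoungDiagram} (hcard : mu.card = nu.card)
    (h : ∀ r, ∑ j ∈ Finset.range r, nu.colLen j ≤ ∑ j ∈ Finset.range r, mu.colLen j) :
    DominanceLE mu nu := by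
  refine ⟨hcard, fun k => ?_⟩
  have rows : ∀ la : YoungDiagram, ∑ i ∈ Finset.range k, la.rowLen i =
      (la.cells.filter (·.1 < k)).card := by
    intro la
    rw [Finset.card_eq_sum_card_fiberwise (f := Prod.fst) (t := Finset.range k) fun q hq =>
      Finset.mem_coe.2 (Finset.mem_range.2 (Finset.mem_filter.1 hq).2)]
    refine Finset.sum_congr rfl fun i hi => ?_
    rw [YoungDiagram.rowLen_eq_card, YoungDiagram.row, Finset.filter_filter]
    refine congrArg _ (Finset.filter_congr fun q _ => ?_)
    rw [Finset.mem_range] at hi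
    omega
  have cols : ∀ (la : YoungDiagram) (r : ℕ),
      ((la.cells.filter (k ≤ ·.1)).filter (·.2 < r)).card =
        ∑ j ∈ Finset.range r, (la.colLen j - k) := by
    intro la r
    rw [Finset.card_eq_sum_card_fiberwise (f := Prod.snd) (t := Finset.range r) fun q hq =>
      Finset.mem_coe.2 (Finset.mem_range.2 (Finset.mem_filter.1 hq).2)]
    refine Finset.sum_congr rfl fun j hj => ?_
    rw [← Nat.card_Ico]
    rw [Finset.mem_range] at hj
    refine Finset.card_bij' (fun q _ => q.1) (fun i _ => (i, j)) ?_ ?_ ?_ ?_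
    · rintro ⟨a, b⟩ hq
      simp only [Finset.mem_filter, YoungDiagram.mem_cells,
        YoungDiagram.mem_iff_lt_colLen] at hq
      obtain ⟨⟨⟨h1, h2⟩, -⟩, rfl⟩ := hq
      exact Finset.mem_Ico.2 ⟨h2, h1⟩
    · intro i hi
      simp only [Finset.mem_filter, YoungDiagram.mem_cells,
        YoungDiagram.mem_iff_lt_colLen]
      rw [Finset.mem_Ico] at hi
      exact ⟨⟨⟨hi.2, hi.1⟩, hj⟩, trivial⟩
    · rintro ⟨a, b⟩ hq
      rw [← (Finset.mem_filter.1 hq).2]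
    · intro i _
      rfl
  have split : ∀ la : YoungDiagram, la.card =
      (la.cells.filter (·.1 < k)).card + (la.cells.filter (k ≤ ·.1)).card := by
    intro la
    rw [YoungDiagram.card, ← Finset.card_filter_add_card_filter_not (s := la.cells) (·.1 < k)]
    simp only [not_lt]
  -- With this `r`, the first `r` columns contain all boxes of `nu` in rows from `k` on, and each
  -- has length at least `k`, so truncated subtraction is exact for `nu`.
  set r := nu.rowLen k with hr
  have hnu : (nu.cells.filter (k ≤ ·.1)).filter (·.2 < r) = nu.cells.filter (k ≤ ·.1) := by
    refine Finset.filter_true_of_mem fun q hq => ?_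
    rw [Finset.mem_filter, YoungDiagram.mem_cells] at hq
    rw [hr, ← YoungDiagram.mem_iff_lt_rowLen]
    exact nu.up_left_mem hq.2 le_rfl hq.1
  have hsub : ∀ j, j < r → k ≤ nu.colLen j := fun j hj =>
    (YoungDiagram.mem_iff_lt_colLen.1 (YoungDiagram.mem_iff_lt_rowLen.2 hj)).le
  have hconst : r * k = ∑ _j ∈ Finset.range r, k := by simp
  have h1 : ∑ j ∈ Finset.range r, (nu.colLen j - k) + r * k =
      ∑ j ∈ Finset.range r, nu.colLen j := by
    rw [hconst, ← Finset.sum_add_distrib]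
    exact Finset.sum_congr rfl fun j hj => Nat.sub_add_cancel (hsub j (Finset.mem_range.1 hj))
  have h2 : ∑ j ∈ Finset.range r, mu.colLen j ≤
      ∑ j ∈ Finset.range r, (mu.colLen j - k) + r * k := by
    rw [hconst, ← Finset.sum_add_distrib]
    exact Finset.sum_le_sum fun j _ => by omega
  have h3 := h r
  have h4 : ((mu.cells.filter (k ≤ ·.1)).filter (·.2 < r)).card ≤
      (mu.cells.filter (k ≤ ·.1)).card := Finset.card_filter_le _ _
  have h5 := cols mu r
  have h6 := cols nu r
  rw [hnu] at h6
  rw [rows, rows]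
  have h7 := split mu
  have h8 := split nu
  omega

theorem DominanceLE.antisymm {mu nu : YoungDiagram} (h : DominanceLE mu nu)
    (h' : DominanceLE nu mu) : mu = nu := by
  have hsum : ∀ k, ∑ i ∈ Finset.range k, mu.rowLen i = ∑ i ∈ Finset.range k, nu.rowLen i :=
    fun k => le_antisymm (h.2 k) (h'.2 k)
  ext ⟨i, j⟩
  have h1 := hsum (i + 1)
  rw [Finset.sum_range_succ, Finset.sum_range_succ, hsum i] at h1
  rw [YoungDiagram.mem_cells, YoungDiagram.mem_cells, YoungDiagram.mem_iff_lt_rowLen,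
    YoungDiagram.mem_iff_lt_rowLen, Nat.add_left_cancel h1]

end Ladders

theorem mainTheorem10 (ℓ : ℕ) (hℓ : 2 < ℓ) (lam : YoungDiagram) :
    ∃ S : YoungDiagram,
      (S : Set (ℕ × ℕ)) = Ladders.deregularization ℓ lam ∧
      S ∈ Ladders.regClass ℓ lam ∧
      (∀ mu ∈ Ladders.regClass ℓ lam, Ladders.DominanceLE S mu) ∧
      (∀ mu ∈ Ladders.regClass ℓ lam,
        (∀ nu ∈ Ladders.regClass ℓ lam, Ladders.DominanceLE mu nu) → mu = S) ∧
      (∀ mu ∈ Ladders.regClass ℓ lam, Ladders.AllLocked ℓ mu ↔ mu = S) := by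
  open Ladders in
  have hg := isGreedy_lockedDiagram hℓ lam
  obtain ⟨p, hp⟩ := hg.exists_isBottom
  obtain ⟨s, hs, hlt⟩ := hg.exists_isSorted hp
  obtain ⟨N, hN⟩ := ladderEnd_eventually ℓ (lockedDiagram ℓ lam)
  obtain ⟨S, rfl⟩ := exists_ladderEnd_eq hs.isEndSeq ⟨N + p, fun j hj => by
    rw [hs.eq j (by omega), hN j (by omega)]⟩
  have hmem : S ∈ regClass ℓ lam := (mem_regClass_iff hℓ).2 hs.sameLevels
  have hdom : ∀ mu ∈ regClass ℓ lam, DominanceLE S mu := fun mu hmu => by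
    refine dominanceLE_of_colLen ((card_eq_of_mem_regClass hℓ hmem).trans
      (card_eq_of_mem_regClass hℓ hmu).symm) fun r => ?_
    have := hs.sum_le hg hp (isEndSeq_ladderEnd ℓ mu) ((mem_regClass_iff hℓ).1 hmu) r
    simp only [ladderEnd, Finset.sum_add_distrib] at this
    exact Nat.le_of_add_le_add_right this
  refine ⟨S, ?_, hmem, hdom, fun mu hmu h => (h S hmem).antisymm (hdom mu hmu), fun mu hmu => ?_⟩
  · ext q
    rw [mem_deregularization_iff hℓ, ← hs.lt_iff hg hp hlt]
    exact mem_iff_lt_ladderEnd ℓ S q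
  · rw [allLocked_iff]
    constructor
    · intro h
      have hmu' := isGreedy_lockedDiagram hℓ mu
      rw [h] at hmu'
      exact ladderEnd_injective ℓ
        ((hg.isSorted_self hp hmu' ((mem_regClass_iff hℓ).1 hmu)).unique hg hs)
    · rintro rfl
      exact ladderEnd_injective ℓ (hs.greedy_eq hg hp (isGreedy_lockedDiagram hℓ mu))
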